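/- Let $K$ be a field of characteristic $2$, let $V$ be a vector space of finite dimension $n$ over $K$, and let $\mathrm{Symm}(V)$ denote the $K$-vector space of symmetric bilinear forms $V\times V\to K$. The rank of a form $f$ is the rank of the linear map $V\to V^*$, $u\mapsto f(u,\cdot)$. Let $\mathcal{M}$ be a $K$-subspace of $\mathrm{Symm}(V)$ such that every non-zero element of $\mathcal{M}$ has rank $r$ or $n$, where $0<r<n$, $r$ is odd and $n$ is even. Then $\dim_K \mathcal{M}\leq n+r$. -/

import Mathlib

/-- The space `Symm(V)` of symmetric bilinear forms on `V × V`. -/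
def Symm (K V : Type*) [Field K] [AddCommGroup V] [Module K V] :
    Submodule K (LinearMap.BilinForm K V) where
  carrier := {f | f.IsSymm}
  add_mem' := fun hf hg => hf.add hg
  zero_mem' := LinearMap.BilinForm.isSymm_zero
  smul_mem' := fun c _ hf => hf.smul c

/-- The rank of a bilinear form `f`: the rank of the linear map `V → V*`, `u ↦ f(u, ·)`. -/
noncomputable def formRank {K V : Type*} [Field K] [AddCommGroup V] [Module K V]
    (f : LinearMap.BilinForm K V) : ℕ :=
  Module.finrank K (LinearMap.range f)

/-! Fix `u ≠ 0`. The map `f ↦ f u` from `M` to the dual of `V` has rank at most `n`. Non-zero forms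
in its kernel `N` are degenerate, so have odd rank `r`; alternating forms have even rank, so `N` has
no non-zero alternating form. Hence the functionals `f ↦ f v v` separate `N`, which gives vectors `a
i` and a basis `F j` of `N` with `F j (a i) (a i) = δ_ij`. The Gram determinants of all subset sums
of the `F j` add up to 1, so one is non-zero and `dim N ≤ r`. -/

open Finset in
theorem Finset.sum_powerset_prod_sum_of_charTwo {ι R : Type*} [Fintype ι] [DecidableEq ι]
    [CommRing R] [CharP R 2] (a : ι → ι → R) :
    ∑ S : Finset ι, ∏ i, ∑ j ∈ S, a i j = ∑ τ : Equiv.Perm ι, ∏ i, a i (τ i) := by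
  have expand (S : Finset ι) : ∏ i, ∑ j ∈ S, a i j =
      ∑ g : ι → ι, if ∀ i, g i ∈ S then ∏ i, a i (g i) else 0 := by
    rw [prod_univ_sum, ← Finset.sum_filter]
    refine Finset.sum_congr ?_ fun _ _ => rfl
    ext g
    simp
  have count (g : ι → ι) : (∑ S : Finset ι, if ∀ i, g i ∈ S then ∏ i, a i (g i) else 0) =
      if Function.Bijective g then ∏ i, a i (g i) else 0 := by
    split_ifs with hg
    · rw [Finset.sum_eq_single univ]
      · simp
      · intro S _ hS
        rw [if_neg]
        intro h
        refine hS (eq_univ_of_forall fun j => ?_)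
        obtain ⟨i, rfl⟩ := hg.2 j
        exact h i
      · simp
    · have hs : ¬ Function.Surjective g := fun h => hg (Finite.surjective_iff_bijective.1 h)
      simp only [Function.Surjective, not_forall, not_exists] at hs
      obtain ⟨k, hk⟩ := hs
      -- Toggling a point `k` missed by `g` pairs off the sets `S` containing the image of `g`.
      refine Finset.sum_involution (fun S _ => symmDiff S {k}) ?_ ?_ ?_ ?_
      · intro S _
        have : (∀ i, g i ∈ symmDiff S {k}) ↔ ∀ i, g i ∈ S := by
          simp [Finset.mem_symmDiff, hk]
        rw [if_congr this rfl rfl]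
        exact CharTwo.add_self_eq_zero _
      · intro S _ _ h
        have := symmDiff_eq_left.1 h
        simp at this
      · simp
      · intro S _
        simp
  rw [Finset.sum_congr rfl fun S _ => expand S, Finset.sum_comm,
    Finset.sum_congr rfl fun g _ => count g, ← Finset.sum_filter]
  symm
  refine Finset.sum_bij (fun τ _ => ⇑τ) ?_ ?_ ?_ ?_
  · intro τ _
    simp
  · intro τ _ τ' _ h
    exact DFunLike.coe_injective h
  · intro g hg
    simp only [mem_filter, mem_univ, true_and] at hg
    exact ⟨Equiv.ofBijective g hg, mem_univ _, rfl⟩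
  · intros; rfl

theorem Matrix.det_eq_sum_prod_of_charTwo {ι R : Type*} [Fintype ι] [DecidableEq ι]
    [CommRing R] [CharP R 2] (A : Matrix ι ι R) :
    A.det = ∑ σ : Equiv.Perm ι, ∏ i, A (σ i) i := by
  rw [Matrix.det_apply]
  refine Finset.sum_congr rfl fun σ _ => ?_
  rcases Int.units_eq_one_or (Equiv.Perm.sign σ) with h | h <;> simp [h, CharTwo.neg_eq]

/-- The sum expands over pairs of permutations `(σ, τ)` into terms `∏ i, F (τ i) (σ i) i`. By
symmetry `(σ, τ)` and `(σ⁻¹, τ * σ⁻¹)` give equal terms, which cancel unless `σ = 1`; there only `τ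
= 1` survives. -/
theorem Matrix.sum_det_sum_eq_one_of_charTwo {ι R : Type*} [Fintype ι] [DecidableEq ι]
    [CommRing R] [CharP R 2] (F : ι → Matrix ι ι R) (hF : ∀ j, (F j).IsSymm)
    (hdiag : ∀ i j, F j i i = if i = j then 1 else 0) :
    ∑ S : Finset ι, (∑ j ∈ S, F j).det = 1 := by
  classical
  simp only [Matrix.det_eq_sum_prod_of_charTwo, Matrix.sum_apply]
  rw [Finset.sum_comm]
  simp only [fun σ : Equiv.Perm ι =>
    Finset.sum_powerset_prod_sum_of_charTwo fun i j => F j (σ i) i]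
  rw [← Finset.sum_erase_add _ _ (Finset.mem_univ (1 : Equiv.Perm ι))]
  have h1 : ∑ τ : Equiv.Perm ι, ∏ i, F (τ i) ((1 : Equiv.Perm ι) i) i = 1 := by
    rw [Finset.sum_eq_single 1]
    · simp [hdiag]
    · intro τ _ hτ
      obtain ⟨i, hi⟩ : ∃ i, τ i ≠ i := by
        by_contra! h
        exact hτ (Equiv.ext h)
      exact Finset.prod_eq_zero (Finset.mem_univ i) (by simp [hdiag, hi.symm])
    · simp
  rw [h1, ← Finset.sum_product', add_eq_right]
  refine Finset.sum_involution (fun p _ => (p.1⁻¹, p.2 * p.1⁻¹)) ?_ ?_ ?_ ?_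
  · rintro ⟨σ, τ⟩ _
    have : ∏ i, F ((τ * σ⁻¹) i) (σ⁻¹ i) i = ∏ i, F (τ i) (σ i) i := by
      rw [← Equiv.prod_comp σ]
      refine Finset.prod_congr rfl fun i _ => ?_
      simpa using (hF (τ i)).apply (σ i) i
    simp only [this]
    exact CharTwo.add_self_eq_zero _
  · rintro ⟨σ, τ⟩ hp _ h
    simp at hp h
    exact hp h.2
  · rintro ⟨σ, τ⟩ hp
    simpa using hp
  · rintro ⟨σ, τ⟩ _
    simp

/-- The terms of `σ` and `σ⁻¹` cancel. If `σ = σ⁻¹`, odd cardinality forces a fixed point, hence a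
zero diagonal factor. -/
theorem Matrix.det_eq_zero_of_odd_card_of_charTwo {ι R : Type*} [Fintype ι] [DecidableEq ι]
    [CommRing R] [CharP R 2] (A : Matrix ι ι R) (hA : A.IsSymm) (hdiag : ∀ i, A i i = 0)
    (hodd : Odd (Fintype.card ι)) : A.det = 0 := by
  rw [Matrix.det_eq_sum_prod_of_charTwo]
  refine Finset.sum_involution (fun σ _ => σ⁻¹) ?_ ?_ ?_ ?_
  · intro σ _
    have : ∏ i, A (σ⁻¹ i) i = ∏ i, A (σ i) i := by
      rw [← Equiv.prod_comp σ]
      refine Finset.prod_congr rfl fun i _ => ?_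
      simpa using hA.apply (σ i) i
    rw [this]
    exact CharTwo.add_self_eq_zero _
  · intro σ _ hne h
    refine hne ?_
    have hinv : σ ^ 2 ^ 1 = 1 := by
      rw [pow_one, sq]
      nth_rewrite 1 [← h]
      simp
    have : Fact (Nat.Prime 2) := ⟨Nat.prime_two⟩
    obtain ⟨i, hi⟩ := Equiv.Perm.exists_fixed_point_of_prime
      (by rwa [← even_iff_two_dvd, Nat.not_even_iff_odd]) hinv
    exact Finset.prod_eq_zero (Finset.mem_univ i) (by rw [hi, hdiag])
  · simp
  · simp

/-- Vectors whose Gram matrix under `f` is invertible bound the rank of `f` from below. -/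
theorem card_le_formRank_of_det_ne_zero {K V ι : Type*} [Field K] [AddCommGroup V] [Module K V]
    [FiniteDimensional K V] [Fintype ι] [DecidableEq ι] (f : LinearMap.BilinForm K V) (v : ι → V)
    (h : (Matrix.of fun i j => f (v i) (v j)).det ≠ 0) : Fintype.card ι ≤ formRank f := by
  have hrows := Matrix.linearIndependent_rows_of_det_ne_zero h
  have hli : LinearIndependent K fun i => f (v i) := by
    let T : Module.Dual K V →ₗ[K] ι → K := LinearMap.pi fun j => Module.Dual.eval K V (v j)
    exact LinearIndependent.of_comp T hrows
  have hli' : LinearIndependent K fun i => f.rangeRestrict (v i) :=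
    LinearIndependent.of_comp (LinearMap.range f).subtype hli
  exact hli'.fintype_card_le_finrank

theorem even_formRank_of_isAlt {K V : Type*} [Field K] [CharP K 2] [AddCommGroup V] [Module K V]
    [FiniteDimensional K V] (f : LinearMap.BilinForm K V) (hs : f.IsSymm) (ha : f.IsAlt) :
    Even (formRank f) := by
  by_contra hodd
  rw [Nat.not_even_iff_odd] at hodd
  let : AddCommGroup (LinearMap.range f) := Submodule.addCommGroup (M := Module.Dual K V) _
  let b : Module.Basis (Fin (formRank f)) K (LinearMap.range f) := Module.finBasis K _
  choose v hv using fun i => (b i).2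
  have hdet := Matrix.det_eq_zero_of_odd_card_of_charTwo (Matrix.of fun i j => f (v i) (v j))
    (by ext i j; exact hs.eq (v j) (v i)) (fun i => ha (v i))
    (by rwa [Fintype.card_fin])
  -- A kernel vector of the Gram matrix yields a vector in the radical of `f`, hence a linear
  -- relation among the basis vectors `b j = f (v j)`.
  obtain ⟨c, hc, h0⟩ := Matrix.exists_mulVec_eq_zero_iff.2 hdet
  have hx (i) : f (v i) (∑ j, c j • v j) = 0 := by
    have := congrFun h0 i
    simp only [Matrix.mulVec, dotProduct, Matrix.of_apply, Pi.zero_apply] at this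
    simpa [mul_comm] using this
  have hy (y : V) : f y (∑ j, c j • v j) = 0 := by
    have hrep := congrArg Subtype.val (b.sum_repr ⟨f y, y, rfl⟩)
    simp only [Submodule.coe_sum, Submodule.coe_smul, ← hv] at hrep
    rw [← hrep, LinearMap.sum_apply]
    exact Finset.sum_eq_zero fun i _ => by rw [LinearMap.smul_apply, hx, smul_zero]
  have hb : ∑ j, c j • b j = 0 := by
    apply Subtype.ext
    simp only [Submodule.coe_sum, Submodule.coe_smul, ← hv]
    ext y
    have hsum : f (∑ j, c j • v j) = ∑ j, c j • f (v j) := by simp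
    rw [← hsum]
    exact (hs.eq _ _).trans (hy y)
  exact hc (funext (Fintype.linearIndependent_iff.1 b.linearIndependent c hb))

/-- A family of linear functionals that separates points contains a basis of the dual space. -/
theorem exists_dual_pair_of_separating {K W α : Type*} [Field K] [AddCommGroup W] [Module K W]
    [FiniteDimensional K W] (φ : α → Module.Dual K W) (h : ∀ w, (∀ a, φ a w = 0) → w = 0) :
    ∃ (v : Fin (Module.finrank K W) → α) (w : Fin (Module.finrank K W) → W),
      ∀ i j, φ (v i) (w j) = if i = j then 1 else 0 := by
  classical
  obtain ⟨κ, a, -, hspan, hli⟩ := exists_linearIndependent' K φ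
  have htop : Submodule.span K (Set.range φ) = ⊤ := by
    rw [← Subspace.dualCoannihilator_dualAnnihilator_eq (W := Submodule.span K (Set.range φ))]
    have : (Submodule.span K (Set.range φ)).dualCoannihilator = ⊥ := by
      rw [eq_bot_iff]
      intro w hw
      rw [Submodule.mem_dualCoannihilator] at hw
      exact h w fun a => hw (φ a) (Submodule.subset_span ⟨a, rfl⟩)
    rw [this, Submodule.dualAnnihilator_bot]
  let B := Module.Basis.mk hli (by rw [hspan, htop])
  have : Fintype κ := FiniteDimensional.fintypeBasisIndex B
  let e : κ ≃ Fin (Module.finrank K W) := Fintype.equivFinOfCardEq <| by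
    rw [← Module.finrank_eq_card_basis B, Subspace.dual_finrank_eq]
  refine ⟨fun i => a (e.symm i), fun j => (Module.evalEquiv K W).symm (B.dualBasis (e.symm j)),
    fun i j => ?_⟩
  have hB : φ (a (e.symm i)) = B (e.symm i) := by simp [B]
  rw [Module.apply_evalEquiv_symm_apply, hB, Module.Basis.dualBasis_apply_self]
  simp

/-- In characteristic two, a space of symmetric bilinear forms that contains no non-zero
alternating form contains a form whose rank is at least the dimension of the space. -/
theorem exists_finrank_le_formRank {K V : Type*} [Field K] [CharP K 2] [AddCommGroup V]
    [Module K V] [FiniteDimensional K V] (N : Submodule K (LinearMap.BilinForm K V))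
    (hN : N ≤ Symm K V) (halt : ∀ f ∈ N, f.IsAlt → f = 0) :
    ∃ f ∈ N, Module.finrank K N ≤ formRank f := by
  classical
  let : AddCommGroup N := Submodule.addCommGroup (M := LinearMap.BilinForm K V) N
  let φ : V → Module.Dual K N := fun v =>
    { toFun := fun f => f.1 v v
      map_add' := fun _ _ => rfl
      map_smul' := fun _ _ => rfl }
  obtain ⟨a, F, hF⟩ := exists_dual_pair_of_separating φ fun f hf => Subtype.ext (halt f.1 f.2 hf)
  have hsum := Matrix.sum_det_sum_eq_one_of_charTwo
    (fun j => Matrix.of fun i k => (F j).1 (a i) (a k))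
    (fun j => by ext i k; exact (hN (F j).2).eq (a k) (a i)) hF
  obtain ⟨S, -, hS⟩ := Finset.exists_ne_zero_of_sum_ne_zero (hsum.trans_ne one_ne_zero)
  refine ⟨(∑ j ∈ S, F j : N), Subtype.mem _, ?_⟩
  refine (Fintype.card_fin _).symm.trans_le (card_le_formRank_of_det_ne_zero _ a ?_)
  convert hS using 2
  ext i k
  simp [Matrix.sum_apply]

theorem theorem5 {K V : Type*} [Field K] [CharP K 2] [AddCommGroup V] [Module K V]
    [FiniteDimensional K V] (n r : ℕ) (hn : Module.finrank K V = n)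
    (hr0 : 0 < r) (hrn : r < n) (hr : Odd r) (hne : Even n)
    (M : Submodule K (LinearMap.BilinForm K V)) (hM : M ≤ Symm K V)
    (hrank : ∀ f ∈ M, f ≠ 0 → formRank f = r ∨ formRank f = n) :
    Module.finrank K M ≤ n + r := by
  have : Nontrivial V := Module.nontrivial_of_finrank_pos (R := K) (by omega)
  obtain ⟨u, hu⟩ := exists_ne (0 : V)
  let : AddCommGroup M := Submodule.addCommGroup (M := LinearMap.BilinForm K V) M
  let T : M →ₗ[K] Module.Dual K V := (LinearMap.applyₗ u).comp M.subtype
  let N : Submodule K (LinearMap.BilinForm K V) := (LinearMap.ker T).map M.subtype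
  have hmem (f) (hf : f ∈ N) : f ∈ M ∧ f u = 0 := by
    obtain ⟨g, hg, rfl⟩ := hf
    exact ⟨g.2, hg⟩
  have hNrank (f) (hf : f ∈ N) (h0 : f ≠ 0) : formRank f = r := by
    refine (hrank f (hmem f hf).1 h0).resolve_right fun h => hu ?_
    have hk := LinearMap.finrank_range_add_finrank_ker f
    rw [hn] at hk
    have hker : LinearMap.ker f = ⊥ := by
      rw [← Submodule.finrank_eq_zero (R := K)]
      unfold formRank at h
      omega
    exact LinearMap.ker_eq_bot'.1 hker u (hmem f hf).2
  have hNsymm : N ≤ Symm K V := fun f hf => hM (hmem f hf).1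
  have hNle : Module.finrank K N ≤ r := by
    obtain ⟨f, hf, hle⟩ := exists_finrank_le_formRank N hNsymm fun f hf ha => by
      by_contra h0
      have := even_formRank_of_isAlt f (hNsymm hf) ha
      rw [hNrank f hf h0] at this
      exact Nat.not_even_iff_odd.2 hr this
    by_cases h0 : f = 0
    · subst h0
      have : formRank (0 : LinearMap.BilinForm K V) = 0 := by
        simp [formRank]
      omega
    · exact hle.trans_eq (hNrank f hf h0)
  have hNker : Module.finrank K N = Module.finrank K (LinearMap.ker T) :=
    (Submodule.equivMapOfInjective M.subtype M.injective_subtype _).finrank_eq.symm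
  have hrange : Module.finrank K (LinearMap.range T) ≤ n := by
    rw [← hn, ← Subspace.dual_finrank_eq (K := K) (V := V)]
    exact Submodule.finrank_le _
  have := LinearMap.finrank_range_add_finrank_ker (V := M) T
  omega
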